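/- **Predictability of the average quality ranking.** Consider a mixed multinomial logit (MMNL) trial-offer market with items $1,\dots,N$, consumer classes $1,\dots,K$ ($K\ge 1$), arrival rates $\lambda_k>0$ and class weights $w_k=\lambda_k/\sum_{l=1}^K\lambda_l$, position visibilities $v_1\ge v_2\ge\dots\ge v_N\ge 0$, appeals $a_{i,k}>0$, qualities $q_{i,k}\in[0,1]$ and a constant $z\ge 0$. Write $\bar q_i=\sum_{k=1}^K w_k q_{i,k}$ for the weighted average quality of item $i$. Let $d_i^t$ be the number of purchases of item $i$ before the arrival of consumer $t$, with $d^0=0$. Let $\sigma$ be a static ranking, i.e. a permutation of $\{1,\dots,N\}$ placing item $i$ in position $\sigma(i)$ for every consumer. In each period $t$ one consumer arrives; independently of the past, she belongs to class $k$ with probability $w_k$; given class $k$, she tries item $i$ with probability $$p_{i,k}(\sigma,d^t)=\frac{v_{\sigma(i)}(a_{i,k}+d_i^t)}{\sum_{j=1}^N v_{\sigma(j)}(a_{j,k}+d_j^t)+z}$$ (and otherwise tries nothing), and then buys the tried item with probability $q_{i,k}$. If she buys item $i$, then $d_i^{t+1}=d_i^t+1$; all other counts stay unchanged. Suppose that $\sigma$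 is the average quality ranking, i.e. it orders the items by decreasing $\bar q_i$, and that $\sigma$ is tie-breaking, i.e. there is an item $i^*$ with $\bar q_{i^*}v_{\sigma(i^*)}>\bar q_i v_{\sigma(i)}$ for all $i\neq i^*$. Suppose also that $\bar q_i v_{\sigma(i)}>0$ for at least one item $i$ (for $N\ge 2$ this follows from tie-breaking). Then this item $i^*$ has the highest weighted average quality, $\bar q_{i^*}=\max_i\bar q_i$, and the market goes predictably to a monopoly for $i^*$: with probability one, its market share $$\phi_{i^*}^t=\frac{d_{i^*}^t}{\sum_{j=1}^N d_j^t}$$ converges to $1$ as $t\to\infty$. -/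

import Mathlib

open Filter Topology MeasureTheory ProbabilityTheory

noncomputable section

/-- The data of a trial-offer market with `N` items and `K` classes of consumers whose choices
follow a mixed multinomial logit. Items and positions are both indexed by `Fin N`; position `0`
is the most visible one. -/
structure MMNL (N K : ℕ) where
  /-- there is at least one class of consumers -/
  classes_pos : 0 < K
  /-- the Poisson arrival rate of each class of consumers -/
  rate : Fin K → ℝ
  rate_pos : ∀ k, 0 < rate k
  /-- the visibility of each position -/
  visibility : Fin N → ℝ
  visibility_nonneg : ∀ j, 0 ≤ visibility j
  visibility_antitone : Antitone visibility
  /-- `appeal i k` is the intrinsic appeal of item `i` for class `k` -/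
  appeal : Fin N → Fin K → ℝ
  appeal_pos : ∀ i k, 0 < appeal i k
  /-- `quality i k` is the probability that a consumer of class `k` who tries item `i` buys it -/
  quality : Fin N → Fin K → ℝ
  quality_nonneg : ∀ i k, 0 ≤ quality i k
  quality_le_one : ∀ i k, quality i k ≤ 1
  /-- the weight of trying no item at all -/
  z : ℝ
  z_nonneg : 0 ≤ z

/-- A vector of past purchases: `d i` is the number of times item `i` has been bought. -/
abbrev Purchases (N : ℕ) : Type := Fin N → ℕ

/-- A ranking sends each item to its position. -/
abbrev Ranking (N : ℕ) : Type := Equiv.Perm (Fin N)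

/-- A ranking policy returns a ranking, given the vector of past purchases. -/
abbrev RankingPolicy (N : ℕ) : Type := Purchases N → Ranking N

/-- The static ranking policy that always displays the ranking `σ`. -/
def staticPolicy {N : ℕ} (σ : Ranking N) : RankingPolicy N := fun _ => σ

namespace MMNL

variable {N K : ℕ} (M : MMNL N K)

/-- The weight of class `k`, i.e. the probability that the next consumer belongs to it. -/
def weight (k : Fin K) : ℝ := M.rate k / ∑ l, M.rate l

/-- The weighted average quality of item `i`. -/
def avgQuality (i : Fin N) : ℝ := ∑ k, M.weight k * M.quality i k

/-- The probability that a consumer of class `k` tries item `i` when the ranking is `σ` and the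
past purchases are `d`. -/
def trialProb (σ : Ranking N) (d : Purchases N) (k : Fin K) (i : Fin N) : ℝ :=
  M.visibility (σ i) * (M.appeal i k + d i) /
    (∑ j, M.visibility (σ j) * (M.appeal j k + d j) + M.z)

lemma weight_nonneg (k : Fin K) : 0 ≤ M.weight k :=
  div_nonneg (M.rate_pos k).le (Finset.sum_nonneg fun l _ => (M.rate_pos l).le)

lemma sum_weight : ∑ k, M.weight k = 1 := by
  have : Nonempty (Fin K) := ⟨⟨0, M.classes_pos⟩⟩
  have h : 0 < ∑ l, M.rate l := Finset.sum_pos (fun l _ => M.rate_pos l) Finset.univ_nonempty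
  simp only [weight, ← Finset.sum_div]
  exact div_self h.ne'

lemma trialNum_nonneg (σ : Ranking N) (d : Purchases N) (k : Fin K) (i : Fin N) :
    0 ≤ M.visibility (σ i) * (M.appeal i k + d i) :=
  mul_nonneg (M.visibility_nonneg _) (add_nonneg (M.appeal_pos i k).le (Nat.cast_nonneg _))

lemma trialProb_nonneg (σ : Ranking N) (d : Purchases N) (k : Fin K) (i : Fin N) :
    0 ≤ M.trialProb σ d k i :=
  div_nonneg (M.trialNum_nonneg σ d k i)
    (add_nonneg (Finset.sum_nonneg fun j _ => M.trialNum_nonneg σ d k j) M.z_nonneg)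

lemma sum_trialProb_le_one (σ : Ranking N) (d : Purchases N) (k : Fin K) :
    ∑ i, M.trialProb σ d k i ≤ 1 := by
  simp only [trialProb, ← Finset.sum_div]
  exact div_le_one_of_le₀ (le_add_of_nonneg_right M.z_nonneg)
    (add_nonneg (Finset.sum_nonneg fun j _ => M.trialNum_nonneg σ d k j) M.z_nonneg)

/-- The law of the class of the next consumer. -/
def classLaw : PMF (Fin K) :=
  PMF.ofFintype (fun k => ENNReal.ofReal (M.weight k)) (by
    rw [← ENNReal.ofReal_sum_of_nonneg fun k _ => M.weight_nonneg k, M.sum_weight,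
      ENNReal.ofReal_one])

/-- The law of the item tried by a consumer of class `k`; `none` means that no item is tried. -/
def trialLaw (σ : Ranking N) (d : Purchases N) (k : Fin K) : PMF (Option (Fin N)) :=
  PMF.ofFintype
    (fun o => o.elim (ENNReal.ofReal (1 - ∑ i, M.trialProb σ d k i))
      (fun i => ENNReal.ofReal (M.trialProb σ d k i))) (by
    rw [Fintype.sum_option]
    simp only [Option.elim]
    rw [← ENNReal.ofReal_sum_of_nonneg fun i _ => M.trialProb_nonneg σ d k i,
      ← ENNReal.ofReal_add (sub_nonneg.2 (M.sum_trialProb_le_one σ d k))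
        (Finset.sum_nonneg fun i _ => M.trialProb_nonneg σ d k i),
      sub_add_cancel, ENNReal.ofReal_one])

/-- The law of the decision to buy (`true`) item `i` by a consumer of class `k` who tries it. -/
def buyLaw (i : Fin N) (k : Fin K) : PMF Bool :=
  PMF.ofFintype
    (fun b => bif b then ENNReal.ofReal (M.quality i k) else ENNReal.ofReal (1 - M.quality i k)) (by
    rw [Fintype.sum_bool]
    simp only [cond_true, cond_false]
    rw [← ENNReal.ofReal_add (M.quality_nonneg i k) (sub_nonneg.2 (M.quality_le_one i k)),
      add_sub_cancel, ENNReal.ofReal_one])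

/-- One time period: a consumer arrives, possibly tries an item, and possibly buys it. This is the
law of the next vector of purchases when the current one is `d` and the ranking is `σ`. -/
def stepLaw (σ : Ranking N) (d : Purchases N) : PMF (Purchases N) :=
  M.classLaw.bind fun k =>
    (M.trialLaw σ d k).bind fun o =>
      o.elim (PMF.pure d) fun i =>
        (M.buyLaw i k).bind fun b =>
          PMF.pure (bif b then Function.update d i (d i + 1) else d)

/-- The transition kernel of the vector of purchases under the ranking policy `f`. -/
def stepKernel (f : RankingPolicy N) : Kernel (Purchases N) (Purchases N) :=
  Kernel.ofFunOfCountable fun d => (M.stepLaw (f d) d).toMeasure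

instance (f : RankingPolicy N) : IsMarkovKernel (M.stepKernel f) :=
  ⟨fun d => inferInstanceAs (IsProbabilityMeasure (M.stepLaw (f d) d).toMeasure)⟩

/-- The same kernel, as a kernel from the past up to time `t` (it reads the state at time `t`). -/
def pastKernel (f : RankingPolicy N) (t : ℕ) :
    Kernel ((s : Finset.Iic t) → Purchases N) (Purchases N) :=
  (M.stepKernel f).comap (fun x => x ⟨t, Finset.mem_Iic.2 le_rfl⟩) (measurable_pi_apply _)

instance (f : RankingPolicy N) (t : ℕ) : IsMarkovKernel (M.pastKernel f t) :=
  inferInstanceAs (IsMarkovKernel ((M.stepKernel f).comap _ _))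

/-- The law of the whole random sequence `(dᵗ)` of vectors of purchases under the ranking policy
`f`, starting with no purchases. -/
def purchaseLaw (f : RankingPolicy N) : Measure (ℕ → Purchases N) :=
  Kernel.trajMeasure (X := fun _ => Purchases N) (Measure.dirac (0 : Purchases N))
    (fun t => M.pastKernel f t)

/-- Under the ranking policy `f`, the market goes predictably to a monopoly for item `i`: with
probability one, the market share of `i` converges to `1`. -/
def GoesToMonopolyFor (f : RankingPolicy N) (i : Fin N) : Prop :=
  ∀ᵐ d ∂(M.purchaseLaw f),
    Tendsto (fun t : ℕ => (d t i : ℝ) / ∑ j, (d t j : ℝ)) atTop (𝓝 1)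

/-- `σ` orders the items by decreasing weighted average quality (ties in any order). -/
def IsAverageQualityRanking (σ : Ranking N) : Prop :=
  ∀ i j, σ i < σ j → M.avgQuality j ≤ M.avgQuality i

/-- Item `i` is the unique item with the highest product of visibility and weighted average
quality under the ranking `σ`. -/
def IsStrictBest (σ : Ranking N) (i : Fin N) : Prop :=
  ∀ j, j ≠ i → M.avgQuality j * M.visibility (σ j) < M.avgQuality i * M.visibility (σ i)

/-- The static ranking `σ` is tie-breaking. -/
def IsTieBreaking (σ : Ranking N) : Prop := ∃ i, M.IsStrictBest σ i

end MMNL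

end

/-!
Write the *score* of an item as its weighted average quality times its visibility. The item `i⋆`
of largest score is bought at time `t` with conditional probability at least `c / (t + 1)`, so
`d_{i⋆} → ∞` almost surely by the conditional Borel–Cantelli lemma.

For another item `j` choose `θ < 1` with `score j < θ * score i⋆`. Once `d_{i⋆}` is large, the
expected relative growth of `d_j` is at most `θ` times that of `d_{i⋆}`, so that
`(a + d_j) * (d_{i⋆} + 1) ^ (-θ)` is eventually a nonnegative supermartingale for a suitable
constant `a`. It converges, hence `d_j = O(d_{i⋆} ^ θ) = o(d_{i⋆})` and the market share of `i⋆`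
tends to `1`.

An item of larger average quality than `i⋆` would be displayed at a position at least as visible,
and would therefore have at least the same score.
-/

section Asymptotics

open Asymptotics

lemma tendsto_div_sum_one_of_isLittleO {α ι 𝕜 : Type*} [Fintype ι] [NormedField 𝕜] {l : Filter α}
    {u : ι → α → 𝕜} {i : ι} (hne : ∀ᶠ t in l, u i t ≠ 0) (h : ∀ j, j ≠ i → u j =o[l] u i) :
    Tendsto (fun t => u i t / ∑ j, u j t) l (𝓝 1) := by
  classical
  have hsum : (fun t => ∑ j, u j t) ~[l] u i := by
    have hrest : (fun t => ∑ j ∈ Finset.univ.erase i, u j t) =o[l] u i :=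
      IsLittleO.fun_sum fun j hj => h j (Finset.ne_of_mem_erase hj)
    refine hrest.congr_left fun t => ?_
    rw [Pi.sub_apply, ← Finset.add_sum_erase _ _ (Finset.mem_univ i), add_sub_cancel_left]
  simpa using ((isEquivalent_iff_tendsto_one hne).1 hsum).inv₀ one_ne_zero

lemma isLittleO_rpow_self_of_lt_one {α : Type*} {l : Filter α} {u : α → ℝ} {θ : ℝ} (hθ : θ < 1)
    (hu : Tendsto u l atTop) : (fun t => u t ^ θ) =o[l] u := by
  have hpos : ∀ᶠ t in l, 0 < u t := hu.eventually_gt_atTop 0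
  rw [isLittleO_iff_tendsto' (hpos.mono fun t ht h => absurd h ht.ne')]
  refine ((tendsto_rpow_neg_atTop (sub_pos.2 hθ)).comp hu).congr' (hpos.mono fun t ht => ?_)
  simp only [Function.comp_apply, neg_sub, Real.rpow_sub_one ht.ne']

lemma rpow_neg_add_one_le {x θ : ℝ} (hx : 0 < x) (h0 : 0 ≤ θ) (h1 : θ ≤ 1) :
    (x + 1) ^ (-θ) ≤ x ^ (-θ) * (1 - θ / (x + 1)) := by
  have hx1 : 0 < x + 1 := by linarith
  have hs : -1 ≤ -(1 / (x + 1)) := neg_le_neg ((div_le_one hx1).2 (by linarith))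
  have hbernoulli := rpow_one_add_le_one_add_mul_self hs h0 h1
  calc (x + 1) ^ (-θ) = x ^ (-θ) * (1 + -(1 / (x + 1))) ^ θ := by
        rw [show 1 + -(1 / (x + 1)) = x / (x + 1) by field_simp; ring, Real.div_rpow hx.le hx1.le,
          Real.rpow_neg hx.le, Real.rpow_neg hx1.le]
        field_simp
    _ ≤ x ^ (-θ) * (1 - θ / (x + 1)) := by
        gcongr
        exact hbernoulli.trans_eq (by ring)

lemma eventually_mul_add_mul_add_le {b c v : ℝ} (C e : ℝ) (hb : 0 ≤ b) (hbc : b < c) (hv : 0 < v)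
    (hC : 0 ≤ C) : ∀ᶠ x : ℝ in atTop, ∀ V, v * x ≤ V → b * (C + V) * (x + e) ≤ c * V * x := by
  have hlim : Tendsto (fun x : ℝ => b * (C / v / x + 1) * (1 + e / x)) atTop
      (𝓝 (b * (0 + 1) * (1 + 0))) :=
    ((tendsto_id.const_div_atTop (C / v)).add_const 1 |>.const_mul b).mul
      ((tendsto_id.const_div_atTop e).const_add 1)
  filter_upwards [hlim.eventually_lt_const (by simpa using hbc), eventually_gt_atTop 0,
    eventually_ge_atTop (-e)] with x hx hx0 hxe V hV
  have hV0 : 0 < V := (mul_pos hv hx0).trans_le hV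
  have hCV : C ≤ C / v / x * V :=
    calc C = C / v / x * (v * x) := by field_simp
      _ ≤ C / v / x * V := by gcongr
  calc b * (C + V) * (x + e) ≤ b * (C / v / x * V + V) * (x + e) := by
        have : 0 ≤ x + e := by linarith
        gcongr
    _ = b * (C / v / x + 1) * (1 + e / x) * (V * x) := by field_simp
    _ ≤ c * (V * x) := by gcongr
    _ = c * V * x := by ring

end Asymptotics

section Supermartingale

variable {Ω : Type*} {m0 : MeasurableSpace Ω} {μ : Measure Ω} [IsFiniteMeasure μ]
  {ℱ : Filtration ℕ m0} {X : ℕ → Ω → ℝ}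

lemma ae_exists_tendsto_of_supermartingale_of_nonneg (hX : Supermartingale X ℱ μ)
    (h0 : ∀ t ω, 0 ≤ X t ω) : ∀ᵐ ω ∂μ, ∃ c, Tendsto (fun t => X t ω) atTop (𝓝 c) := by
  have hbdd (t : ℕ) : eLpNorm ((-X) t) 1 μ ≤ (∫ ω, X 0 ω ∂μ).toNNReal := by
    have hmean : ∫ ω, X t ω ∂μ ≤ ∫ ω, X 0 ω ∂μ := by
      simpa using hX.setIntegral_le (Nat.zero_le t) MeasurableSet.univ
    rw [Pi.neg_apply, eLpNorm_neg, eLpNorm_one_eq_lintegral_enorm,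
      ← ofReal_integral_norm_eq_lintegral_enorm (hX.integrable t)]
    simp only [Real.norm_of_nonneg (h0 t _)]
    exact ENNReal.ofReal_le_ofReal hmean
  filter_upwards [hX.neg.exists_ae_tendsto_of_bdd hbdd] with ω ⟨c, hc⟩
  exact ⟨-c, by simpa using hc.neg⟩

lemma ae_exists_tendsto_of_forall_condExp_sub_nonpos (hX : StronglyAdapted ℱ X)
    (hint : ∀ t, Integrable (X t) μ) (h0 : ∀ t ω, 0 ≤ X t ω) :
    ∀ᵐ ω ∂μ, (∀ t, (μ[X (t + 1) - X t | ℱ t]) ω ≤ 0) →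
      ∃ c, Tendsto (fun t => X t ω) atTop (𝓝 c) := by
  -- `B t` is known at time `t - 1`, so `X` killed at its first upward drift is a supermartingale.
  let B : ℕ → Set Ω := fun t => {ω | ∀ s < t, (μ[X (s + 1) - X s | ℱ s]) ω ≤ 0}
  have hB_succ (t : ℕ) : MeasurableSet[ℱ t] (B (t + 1)) := by
    simp only [B, Set.ofPred_forall]
    refine MeasurableSet.iInter fun s => MeasurableSet.iInter fun hs =>
      ℱ.mono (Nat.lt_succ_iff.1 hs) _ ?_
    exact measurableSet_le stronglyMeasurable_condExp.measurable measurable_const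
  have hB (t : ℕ) : MeasurableSet[ℱ t] (B t) := by
    cases t with
    | zero => simp [B]
    | succ t => exact ℱ.mono t.le_succ _ (hB_succ t)
  have hkilled : Supermartingale (fun t => (B t).indicator (X t)) ℱ μ := by
    refine supermartingale_nat (fun t => (hX t).indicator (hB t))
      (fun t => (hint t).indicator (ℱ.le t _ (hB t))) fun t => ?_
    have hXt : μ[X t | ℱ t] = X t := condExp_of_stronglyMeasurable (ℱ.le t) (hX t) (hint t)
    filter_upwards [condExp_indicator (hint (t + 1)) (hB_succ t),
      condExp_sub (hint (t + 1)) (hint t) (ℱ t)] with ω hind hsub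
    rw [hind]
    by_cases hω : ω ∈ B (t + 1)
    · have hdrift := hω t t.lt_succ_self
      rw [hsub, hXt, Pi.sub_apply, sub_nonpos] at hdrift
      have hωt : ω ∈ B t := fun s hs => hω s (hs.trans t.lt_succ_self)
      simpa [hω, hωt] using hdrift
    · simpa [hω] using Set.indicator_nonneg (fun ω _ => h0 t ω) ω
  filter_upwards [ae_exists_tendsto_of_supermartingale_of_nonneg hkilled
    fun t ω => Set.indicator_nonneg (fun ω _ => h0 t ω) ω] with ω hlim hω
  have hmem (t : ℕ) : ω ∈ B t := fun s _ => hω s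
  simpa [hmem] using hlim

lemma ae_exists_tendsto_of_eventually_condExp_sub_nonpos (hX : StronglyAdapted ℱ X)
    (hint : ∀ t, Integrable (X t) μ) (h0 : ∀ t ω, 0 ≤ X t ω) :
    ∀ᵐ ω ∂μ, (∀ᶠ t in atTop, (μ[X (t + 1) - X t | ℱ t]) ω ≤ 0) →
      ∃ c, Tendsto (fun t => X t ω) atTop (𝓝 c) := by
  have hshift (s : ℕ) : ∀ᵐ ω ∂μ, (∀ t, (μ[X (t + 1 + s) - X (t + s) | ℱ (t + s)]) ω ≤ 0) →
      ∃ c, Tendsto (fun t => X (t + s) ω) atTop (𝓝 c) := by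
    let ℱs : Filtration ℕ m0 :=
      ⟨fun t => ℱ (t + s), fun _ _ h => ℱ.mono (Nat.add_le_add_right h s), fun _ => ℱ.le _⟩
    exact ae_exists_tendsto_of_forall_condExp_sub_nonpos (ℱ := ℱs) (X := fun t => X (t + s))
      (fun t => hX (t + s)) (fun t => hint (t + s)) fun t => h0 (t + s)
  filter_upwards [ae_all_iff.2 hshift] with ω hω hev
  obtain ⟨s, hs⟩ := eventually_atTop.1 hev
  obtain ⟨c, hc⟩ := hω s fun t => by
    simpa only [add_right_comm] using hs (t + s) (Nat.le_add_left s t)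
  exact ⟨c, (tendsto_add_atTop_iff_nat (f := fun t => X t ω) s).1 hc⟩

end Supermartingale

namespace MMNL

variable {N K : ℕ} (M : MMNL N K) (σ : Ranking N) (f : RankingPolicy N)

/-- The vector of purchases after one period in which the sale `o` was made, starting from `d`;
`none` means that nothing was sold. -/
def afterSale (d : Purchases N) (o : Option (Fin N)) : Purchases N :=
  o.elim d fun i => Function.update d i (d i + 1)

/-- The law of the item sold in one period; `none` means that nothing is sold. -/
noncomputable def saleLaw (d : Purchases N) : PMF (Option (Fin N)) :=
  M.classLaw.bind fun k =>
    (M.trialLaw σ d k).bind fun o =>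
      o.elim (PMF.pure none) fun i => (M.buyLaw i k).map fun b => bif b then some i else none

/-- The probability that the next consumer buys item `i`, averaged over her class. -/
noncomputable def buyProb (d : Purchases N) (i : Fin N) : ℝ := (M.saleLaw σ d (some i)).toReal

/-- The generator of the purchase process: the expected change of `F` over one period that starts
from `d`, under the ranking `σ`. -/
noncomputable def drift (F : Purchases N → ℝ) (d : Purchases N) : ℝ :=
  ∑ i, M.buyProb σ d i * (F (Function.update d i (d i + 1)) - F d)

lemma stepLaw_eq_map_saleLaw (d : Purchases N) :
    M.stepLaw σ d = (M.saleLaw σ d).map (afterSale d) := by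
  rw [stepLaw, saleLaw, PMF.map_bind]
  refine congrArg _ (funext fun k => ?_)
  rw [PMF.map_bind]
  refine congrArg _ (funext fun o => ?_)
  cases o with
  | none => exact (PMF.pure_map (afterSale d) none).symm
  | some i =>
    simp only [Option.elim_some, PMF.map_comp]
    refine congrArg _ (funext fun b => ?_)
    cases b <;> rfl

lemma buyProb_nonneg (d : Purchases N) (i : Fin N) : 0 ≤ M.buyProb σ d i := ENNReal.toReal_nonneg

lemma buyProb_eq_sum (d : Purchases N) (i : Fin N) :
    M.buyProb σ d i = ∑ k, M.weight k * (M.trialProb σ d k i * M.quality i k) := by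
  have hsale : M.saleLaw σ d (some i) = ∑ k, ENNReal.ofReal (M.weight k) *
      (ENNReal.ofReal (M.trialProb σ d k i) * ENNReal.ofReal (M.quality i k)) := by
    simp [saleLaw, classLaw, trialLaw, buyLaw, tsum_fintype, Finset.sum_filter]
  rw [buyProb, hsale, ENNReal.toReal_sum (by finiteness)]
  simp only [ENNReal.toReal_mul, ENNReal.toReal_ofReal, M.weight_nonneg, M.trialProb_nonneg,
    M.quality_nonneg]

lemma integral_stepLaw (F : Purchases N → ℝ) (d : Purchases N) :
    ∫ y, F y ∂(M.stepLaw σ d).toMeasure = F d + M.drift σ F d := by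
  let _ : MeasurableSpace (Option (Fin N)) := ⊤
  have hmass : ∑ o, (M.saleLaw σ d o).toReal = 1 := by
    rw [← ENNReal.toReal_sum fun o _ => PMF.apply_ne_top _ o,
      ← tsum_fintype (L := .unconditional _), PMF.tsum_coe, ENNReal.toReal_one]
  have hmap : (M.stepLaw σ d).toMeasure = (M.saleLaw σ d).toMeasure.map (afterSale d) := by
    rw [stepLaw_eq_map_saleLaw, PMF.toMeasure_map _ _ measurable_from_top]
  calc ∫ y, F y ∂(M.stepLaw σ d).toMeasure
      = ∑ o, (M.saleLaw σ d o).toReal * F (afterSale d o) := by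
        rw [hmap, integral_map measurable_from_top.aemeasurable (by fun_prop), PMF.integral_eq_sum]
        rfl
    _ = F d + ∑ o, (M.saleLaw σ d o).toReal * (F (afterSale d o) - F d) := by
        simp only [mul_sub, Finset.sum_sub_distrib, ← Finset.sum_mul, hmass]
        ring
    _ = F d + M.drift σ F d := by simp [Fintype.sum_option, afterSale, drift, buyProb]

lemma afterSale_mem_Icc (d : Purchases N) (o : Option (Fin N)) :
    afterSale d o ∈ Set.Icc d (d + 1) := by
  cases o with
  | none => exact ⟨le_rfl, le_add_of_nonneg_right zero_le_one⟩
  | some i =>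
    refine ⟨le_update_self_iff.2 (d i).le_succ, fun j => ?_⟩
    obtain rfl | hj := eq_or_ne j i <;> simp [afterSale, *]

lemma ae_stepLaw_mem_Icc (d : Purchases N) :
    ∀ᵐ y ∂(M.stepLaw σ d).toMeasure, y ∈ Set.Icc d (d + 1) := by
  let _ : MeasurableSpace (Option (Fin N)) := ⊤
  rw [stepLaw_eq_map_saleLaw, ← PMF.toMeasure_map _ _ measurable_from_top,
    ae_map_iff measurable_from_top.aemeasurable .of_discrete]
  exact ae_of_all _ (afterSale_mem_Icc d)

instance : IsProbabilityMeasure (M.purchaseLaw f) :=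
  inferInstanceAs (IsProbabilityMeasure (Kernel.trajMeasure _ _))

lemma ae_purchaseLaw_zero : ∀ᵐ d ∂(M.purchaseLaw f), d 0 = 0 := by
  have hmap : (M.purchaseLaw f).map (Preorder.frestrictLe 0) =
      (Measure.dirac (0 : Purchases N)).map
        (MeasurableEquiv.piUnique fun _ : Finset.Iic 0 => Purchases N).symm := by
    rw [purchaseLaw, Kernel.trajMeasure, Measure.map_comp _ _ (by fun_prop),
      Kernel.traj_map_frestrictLe, Kernel.partialTraj_self, Measure.id_comp]
  have hstart : ∀ᵐ x ∂((M.purchaseLaw f).map (Preorder.frestrictLe 0)),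
      x ⟨0, Finset.mem_Iic.2 le_rfl⟩ = 0 := by
    rw [hmap, ae_map_iff (MeasurableEquiv.measurable _).aemeasurable
      (measurableSet_eq_fun (measurable_pi_apply _) measurable_const)]
    exact (ae_dirac_iff .of_discrete).2 rfl
  exact ae_of_ae_map (by fun_prop) hstart

lemma ae_purchaseLaw_succ_mem_Icc :
    ∀ᵐ d ∂(M.purchaseLaw f), ∀ t, d (t + 1) ∈ Set.Icc (d t) (d t + 1) := by
  refine ae_all_iff.2 fun t => ?_
  have hstep : ∀ᵐ p ∂((M.purchaseLaw f).map fun x => (Preorder.frestrictLe t x, x (t + 1))),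
      p.2 ∈ Set.Icc (p.1 ⟨t, Finset.mem_Iic.2 le_rfl⟩)
        (p.1 ⟨t, Finset.mem_Iic.2 le_rfl⟩ + 1) := by
    rw [purchaseLaw, ← Kernel.map_frestrictLe_trajMeasure_compProd_eq_map_trajMeasure]
    refine Measure.ae_compProd_of_ae_ae ?_ (ae_of_all _ fun x => M.ae_stepLaw_mem_Icc _ _)
    exact (measurableSet_le (by fun_prop) measurable_snd).inter
      (measurableSet_le measurable_snd (by fun_prop))
  exact ae_of_ae_map (by fun_prop) hstep

lemma ae_purchaseLaw_le : ∀ᵐ d ∂(M.purchaseLaw f), ∀ t i, d t i ≤ t := by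
  filter_upwards [M.ae_purchaseLaw_succ_mem_Icc f, M.ae_purchaseLaw_zero f] with d hstep h0 t i
  induction t with
  | zero => simp [h0]
  | succ t ih => exact ((hstep t).2 i).trans (Nat.succ_le_succ ih)

/-- The filtration of the purchase process: at time `t`, the vectors of purchases up to time `t`
are known. -/
noncomputable abbrev history (N : ℕ) :
    Filtration ℕ (MeasurableSpace.pi (X := fun _ : ℕ => Purchases N)) :=
  Filtration.piLE (X := fun _ : ℕ => Purchases N)

lemma stronglyAdapted_history (F : Purchases N → ℝ) :
    StronglyAdapted (history N) fun t d => F (d t) := fun t => by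
  rw [history, Filtration.piLE_eq_comap_frestrictLe]
  have hF : Measurable F := .of_discrete
  exact (hF.comp ((measurable_pi_apply (⟨t, Finset.mem_Iic.2 le_rfl⟩ : Finset.Iic t)).comp
    (comap_measurable (Preorder.frestrictLe t)))).stronglyMeasurable

lemma integrable_purchaseLaw (F : Purchases N → ℝ) (t : ℕ) :
    Integrable (fun d => F (d t)) (M.purchaseLaw f) := by
  obtain ⟨C, hC⟩ := ((Set.finite_Iic fun _ : Fin N => t).image fun d => ‖F d‖).bddAbove
  refine Integrable.of_bound
    ((stronglyAdapted_history F t).mono ((history N).le t)).aestronglyMeasurable C ?_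
  filter_upwards [M.ae_purchaseLaw_le f] with d hd using hC ⟨d t, hd t, rfl⟩

lemma condExp_purchaseLaw_succ_sub (F : Purchases N → ℝ) (t : ℕ) :
    (M.purchaseLaw f)[fun d => F (d (t + 1)) - F (d t) | history N t]
      =ᵐ[M.purchaseLaw f] fun d => M.drift (f (d t)) F (d t) := by
  have hnext : (M.purchaseLaw f)[fun d => F (d (t + 1)) | history N t]
      =ᵐ[M.purchaseLaw f] fun d => F (d t) + M.drift (f (d t)) F (d t) := by
    rw [history, Filtration.piLE_eq_comap_frestrictLe]
    have hF : Measurable F := .of_discrete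
    have hcond := condExp_prod_ae_eq_integral_condDistrib
      (X := Preorder.frestrictLe (π := fun _ : ℕ => Purchases N) t)
      (Y := fun d : ℕ → Purchases N => d (t + 1)) (f := fun p => F p.2)
      (by fun_prop) (measurable_pi_apply _).aemeasurable
      (hF.comp measurable_snd).stronglyMeasurable (M.integrable_purchaseLaw f F (t + 1))
    have hkernel := ae_of_ae_map (Preorder.measurable_frestrictLe t).aemeasurable
      (Kernel.condDistrib_trajMeasure (X := fun _ => Purchases N)
        (μ₀ := Measure.dirac (0 : Purchases N)) (κ := fun t => M.pastKernel f t) (a := t))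
    refine hcond.trans (hkernel.mono fun d hd => ?_)
    exact (congrArg (fun m : Measure (Purchases N) => ∫ y, F y ∂m) hd).trans
      (M.integral_stepLaw _ F (d t))
  have hnow : (M.purchaseLaw f)[fun d => F (d t) | history N t] = fun d => F (d t) :=
    condExp_of_stronglyMeasurable _ (stronglyAdapted_history F t) (M.integrable_purchaseLaw f F t)
  filter_upwards [condExp_sub (M.integrable_purchaseLaw f F (t + 1))
    (M.integrable_purchaseLaw f F t) (history N t), hnext] with d hsub hd
  exact hsub.trans (by rw [Pi.sub_apply, hd, hnow, add_sub_cancel_left])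

/-- The visibility of item `i` under the ranking `σ` times its weighted average quality. -/
noncomputable def score (i : Fin N) : ℝ := M.avgQuality i * M.visibility (σ i)

/-- The part of the total attraction that is due to past purchases. -/
noncomputable def load (d : Purchases N) : ℝ := ∑ j, M.visibility (σ j) * d j

/-- The total attraction for class `k` before any purchase, including that of trying nothing. -/
noncomputable def baseAttraction (k : Fin K) : ℝ := ∑ j, M.visibility (σ j) * M.appeal j k + M.z

lemma avgQuality_nonneg (i : Fin N) : 0 ≤ M.avgQuality i :=
  Finset.sum_nonneg fun k _ => mul_nonneg (M.weight_nonneg k) (M.quality_nonneg i k)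

lemma score_nonneg (i : Fin N) : 0 ≤ M.score σ i :=
  mul_nonneg (M.avgQuality_nonneg i) (M.visibility_nonneg _)

lemma nonneg_of_forall_appeal_le {i : Fin N} {a : ℝ} (ha : ∀ k, M.appeal i k ≤ a) : 0 ≤ a :=
  (M.appeal_pos i ⟨0, M.classes_pos⟩).le.trans (ha _)

lemma visibility_mul_le_load (d : Purchases N) (i : Fin N) :
    M.visibility (σ i) * d i ≤ M.load σ d :=
  Finset.single_le_sum (f := fun j => M.visibility (σ j) * (d j : ℝ))
    (fun _ _ => mul_nonneg (M.visibility_nonneg _) (Nat.cast_nonneg _)) (Finset.mem_univ i)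

lemma load_nonneg (d : Purchases N) : 0 ≤ M.load σ d :=
  Finset.sum_nonneg fun _ _ => mul_nonneg (M.visibility_nonneg _) (Nat.cast_nonneg _)

lemma load_le_sum_visibility_mul {d : Purchases N} {t : ℕ} (hd : ∀ i, d i ≤ t) :
    M.load σ d ≤ (∑ j, M.visibility (σ j)) * t := by
  rw [load, Finset.sum_mul]
  have hvis (j : Fin N) := M.visibility_nonneg (σ j)
  gcongr with j
  exacts [hvis j, hd j]

lemma visibility_mul_appeal_le_baseAttraction (i : Fin N) (k : Fin K) :
    M.visibility (σ i) * M.appeal i k ≤ M.baseAttraction σ k :=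
  (Finset.single_le_sum (f := fun j => M.visibility (σ j) * M.appeal j k)
    (fun _ _ => mul_nonneg (M.visibility_nonneg _) (M.appeal_pos _ _).le)
    (Finset.mem_univ i)).trans (le_add_of_nonneg_right M.z_nonneg)

lemma baseAttraction_nonneg (k : Fin K) : 0 ≤ M.baseAttraction σ k :=
  add_nonneg (Finset.sum_nonneg fun _ _ => mul_nonneg (M.visibility_nonneg _)
    (M.appeal_pos _ _).le) M.z_nonneg

lemma trialProb_eq_div (d : Purchases N) (k : Fin K) (i : Fin N) :
    M.trialProb σ d k i =
      M.visibility (σ i) * (M.appeal i k + d i) / (M.baseAttraction σ k + M.load σ d) := by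
  simp only [trialProb, baseAttraction, load, mul_add, Finset.sum_add_distrib, add_right_comm]

lemma score_mul_eq_sum (i : Fin N) (c : ℝ) :
    M.score σ i * c = ∑ k, M.weight k * (M.visibility (σ i) * c * M.quality i k) := by
  rw [score, avgQuality, mul_assoc, Finset.sum_mul]
  exact Finset.sum_congr rfl fun k _ => by ring

lemma buyProb_le {a : ℝ} {i : Fin N} (ha : ∀ k, M.appeal i k ≤ a) {d : Purchases N}
    (hd : 0 < M.load σ d) : M.buyProb σ d i ≤ M.score σ i * ((a + d i) / M.load σ d) := by
  rw [buyProb_eq_sum, score_mul_eq_sum]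
  refine Finset.sum_le_sum fun k _ => mul_le_mul_of_nonneg_left
    (mul_le_mul_of_nonneg_right ?_ (M.quality_nonneg i k)) (M.weight_nonneg k)
  have hvis := M.visibility_nonneg (σ i)
  have hbase := M.baseAttraction_nonneg σ k
  have happeal := M.appeal_pos i k
  rw [trialProb_eq_div, mul_div_assoc]
  gcongr
  exacts [by linarith [ha k], ha k, le_add_of_nonneg_left hbase]

lemma le_buyProb {a C : ℝ} {i : Fin N} (ha : ∀ k, a ≤ M.appeal i k)
    (hC : ∀ k, M.baseAttraction σ k ≤ C) (d : Purchases N) :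
    M.score σ i * ((a + d i) / (C + M.load σ d)) ≤ M.buyProb σ d i := by
  rw [buyProb_eq_sum, score_mul_eq_sum]
  refine Finset.sum_le_sum fun k _ => mul_le_mul_of_nonneg_left
    (mul_le_mul_of_nonneg_right ?_ (M.quality_nonneg i k)) (M.weight_nonneg k)
  rw [trialProb_eq_div, mul_div_assoc]
  obtain hvis | hvis := (M.visibility_nonneg (σ i)).eq_or_lt
  · simp [← hvis]
  have hload := M.load_nonneg σ d
  have hbase : 0 < M.baseAttraction σ k :=
    (mul_pos hvis (M.appeal_pos i k)).trans_le (M.visibility_mul_appeal_le_baseAttraction σ i k)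
  have happeal := M.appeal_pos i k
  gcongr
  exacts [ha k, hC k]

lemma exists_div_le_buyProb {i : Fin N} (hi : 0 < M.score σ i) :
    ∃ c > 0, ∀ (t : ℕ) (d : Purchases N), (∀ j, d j ≤ t) →
      c * (1 / ((t : ℝ) + 1)) ≤ M.buyProb σ d i := by
  have : Nonempty (Fin K) := ⟨⟨0, M.classes_pos⟩⟩
  have hvis : 0 < M.visibility (σ i) := pos_of_mul_pos_right hi (M.avgQuality_nonneg i)
  obtain ⟨k, hk⟩ := Finite.exists_min (M.appeal i)
  obtain ⟨C, hC⟩ := (Set.finite_range (M.baseAttraction σ)).bddAbove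
  have hC0 : 0 < C := (mul_pos hvis (M.appeal_pos i k)).trans_le
    ((M.visibility_mul_appeal_le_baseAttraction σ i k).trans (hC ⟨k, rfl⟩))
  set S := ∑ j, M.visibility (σ j)
  have hS : 0 ≤ S := Finset.sum_nonneg fun j _ => M.visibility_nonneg _
  have ha := M.appeal_pos i k
  refine ⟨M.score σ i * (M.appeal i k / (C + S)), by positivity, fun t d hd => ?_⟩
  have hload := M.load_nonneg σ d
  have hattraction : C + M.load σ d ≤ (C + S) * (t + 1) := by
    linear_combination
      M.load_le_sum_visibility_mul σ hd + C * (Nat.cast_nonneg t : (0 : ℝ) ≤ t) + hS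
  calc M.score σ i * (M.appeal i k / (C + S)) * (1 / ((t : ℝ) + 1))
      = M.score σ i * (M.appeal i k / ((C + S) * (t + 1))) := by field_simp
    _ ≤ M.score σ i * ((M.appeal i k + d i) / (C + M.load σ d)) := by
        gcongr
        exact le_add_of_nonneg_right (Nat.cast_nonneg _)
    _ ≤ M.buyProb σ d i := M.le_buyProb σ hk (fun k => hC ⟨k, rfl⟩) d

lemma drift_eval (d : Purchases N) (i : Fin N) :
    M.drift σ (fun d => (d i : ℝ)) d = M.buyProb σ d i := by
  rw [drift, Fintype.sum_eq_single i fun j hj => by simp [Function.update_of_ne hj.symm]]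
  simp

lemma ae_tendsto_purchases_atTop {i : Fin N} (hi : 0 < M.score σ i) :
    ∀ᵐ d ∂(M.purchaseLaw (staticPolicy σ)), Tendsto (fun t => (d t i : ℝ)) atTop atTop := by
  obtain ⟨c, hc, hbuy⟩ := M.exists_div_le_buyProb σ hi
  have hstep := M.ae_purchaseLaw_succ_mem_Icc (staticPolicy σ)
  have hborelCantelli := tendsto_sum_indicator_atTop_iff (μ := M.purchaseLaw (staticPolicy σ))
    (f := fun t d => (d t i : ℝ)) (R := 1)
    (hstep.mono fun d hd t => by exact_mod_cast (hd t).1 i)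
    (stronglyAdapted_history fun d => (d i : ℝ))
    (M.integrable_purchaseLaw _ fun d => (d i : ℝ))
    (hstep.mono fun d hd t => by
      have hlow : (d t i : ℝ) ≤ d (t + 1) i := by exact_mod_cast (hd t).1 i
      have hhigh : (d (t + 1) i : ℝ) ≤ d t i + 1 := by exact_mod_cast (hd t).2 i
      simpa [abs_le] using ⟨by linarith, by linarith⟩)
  filter_upwards [hborelCantelli, M.ae_purchaseLaw_le (staticPolicy σ),
    ae_all_iff.2 (M.condExp_purchaseLaw_succ_sub (staticPolicy σ) fun d => (d i : ℝ))]
    with d hiff hle hcond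
  refine hiff.2 (tendsto_atTop_mono (fun n => ?_)
    (Real.tendsto_sum_range_one_div_nat_succ_atTop.const_mul_atTop hc))
  rw [Finset.mul_sum, predictablePart, Finset.sum_apply]
  refine Finset.sum_le_sum fun t _ => (hbuy t (d t) (hle t)).trans_eq ?_
  exact ((hcond t).trans (M.drift_eval σ (d t) i)).symm

lemma eventually_buyProb_le {i j : Fin N} {a θ : ℝ} (hi : 0 < M.score σ i) (hθ0 : 0 ≤ θ)
    (hθ : M.score σ j < M.score σ i * θ) (ha : ∀ k, M.appeal j k ≤ a) :
    ∀ᶠ d : Purchases N in comap (fun d => (d i : ℝ)) atTop,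
      M.buyProb σ d j ≤ M.buyProb σ d i * ((a + d j) * (θ / (d i + 2))) := by
  have hvis : 0 < M.visibility (σ i) := pos_of_mul_pos_right hi (M.avgQuality_nonneg i)
  have ha0 : 0 ≤ a := M.nonneg_of_forall_appeal_le ha
  obtain ⟨C, hC⟩ := (Set.finite_range (M.baseAttraction σ)).bddAbove
  have hC0 : 0 ≤ C := (M.baseAttraction_nonneg σ ⟨0, M.classes_pos⟩).trans (hC ⟨_, rfl⟩)
  filter_upwards [((eventually_mul_add_mul_add_le C 2 (M.score_nonneg σ j) hθ hvis hC0).and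
    (eventually_gt_atTop 0)).comap fun d : Purchases N => (d i : ℝ)] with d ⟨hscore, hdi⟩
  have hload : 0 < M.load σ d := (mul_pos hvis hdi).trans_le (M.visibility_mul_le_load σ d i)
  have hratio : M.score σ j / M.load σ d ≤
      M.score σ i * θ * d i / ((C + M.load σ d) * (d i + 2)) := by
    rw [div_le_div_iff₀ hload (by positivity)]
    linear_combination hscore _ (M.visibility_mul_le_load σ d i)
  calc M.buyProb σ d j ≤ M.score σ j * ((a + d j) / M.load σ d) := M.buyProb_le σ ha hload
    _ = M.score σ j / M.load σ d * (a + d j) := by ring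
    _ ≤ M.score σ i * θ * d i / ((C + M.load σ d) * (d i + 2)) * (a + d j) := by gcongr
    _ = M.score σ i * ((0 + d i) / (C + M.load σ d)) * ((a + d j) * (θ / (d i + 2))) := by
        field_simp
        ring
    _ ≤ M.buyProb σ d i * ((a + d j) * (θ / (d i + 2))) := by
        gcongr
        exact M.le_buyProb σ (fun k => (M.appeal_pos i k).le) (fun k => hC ⟨k, rfl⟩) d

/-- The Lyapunov function that compares the purchases of item `j` with the `θ`-th power of those
of item `i`. The shift by `1` avoids the junk value of a negative power at `0`. -/
noncomputable def lyapunov (a θ : ℝ) (i j : Fin N) (d : Purchases N) : ℝ :=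
  (a + d j) * ((d i : ℝ) + 1) ^ (-θ)

lemma lyapunov_nonneg {a : ℝ} (ha : 0 ≤ a) (θ : ℝ) (i j : Fin N) (d : Purchases N) :
    0 ≤ lyapunov a θ i j d := by
  unfold lyapunov
  positivity

lemma drift_lyapunov_nonpos {i j : Fin N} (hij : i ≠ j) {a θ : ℝ} (ha : 0 ≤ a) (h0 : 0 ≤ θ)
    (h1 : θ ≤ 1) {d : Purchases N}
    (hbuy : M.buyProb σ d j ≤ M.buyProb σ d i * ((a + d j) * (θ / (d i + 2)))) :
    M.drift σ (lyapunov a θ i j) d ≤ 0 := by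
  set x : ℝ := d i + 1 with hx
  have hx0 : 0 < x := by positivity
  have hbuy_i := M.buyProb_nonneg σ d i
  have hdrift : M.drift σ (lyapunov a θ i j) d =
      M.buyProb σ d i * ((a + d j) * ((x + 1) ^ (-θ) - x ^ (-θ))) +
        M.buyProb σ d j * x ^ (-θ) := by
    rw [drift, Fintype.sum_eq_add i j hij fun l hl => by
      simp [lyapunov, Function.update_of_ne hl.1.symm, Function.update_of_ne hl.2.symm]]
    simp only [lyapunov, Function.update_self, Function.update_of_ne hij,
      Function.update_of_ne hij.symm, Nat.cast_add, Nat.cast_one, hx]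
    ring
  calc M.drift σ (lyapunov a θ i j) d
      ≤ M.buyProb σ d i * ((a + d j) * (x ^ (-θ) * (1 - θ / (x + 1)) - x ^ (-θ))) +
        M.buyProb σ d i * ((a + d j) * (θ / (d i + 2))) * x ^ (-θ) := by
        rw [hdrift]
        gcongr
        exact rpow_neg_add_one_le hx0 h0 h1
    _ = 0 := by
        rw [hx]
        ring

lemma ae_exists_tendsto_lyapunov {i j : Fin N} (hij : i ≠ j) {a θ : ℝ} (hi : 0 < M.score σ i)
    (h0 : 0 ≤ θ) (h1 : θ ≤ 1) (hθ : M.score σ j < M.score σ i * θ)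
    (ha : ∀ k, M.appeal j k ≤ a) :
    ∀ᵐ d ∂(M.purchaseLaw (staticPolicy σ)),
      ∃ c, Tendsto (fun t => lyapunov a θ i j (d t)) atTop (𝓝 c) := by
  have ha0 : 0 ≤ a := M.nonneg_of_forall_appeal_le ha
  filter_upwards [M.ae_tendsto_purchases_atTop σ hi,
    ae_all_iff.2 (M.condExp_purchaseLaw_succ_sub (staticPolicy σ) (lyapunov a θ i j)),
    ae_exists_tendsto_of_eventually_condExp_sub_nonpos
      (stronglyAdapted_history (lyapunov a θ i j))
      (M.integrable_purchaseLaw (staticPolicy σ) (lyapunov a θ i j))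
      fun t d => lyapunov_nonneg ha0 θ i j (d t)] with d htop hcond hconv
  refine hconv ?_
  have hcomap : Tendsto d atTop (comap (fun d : Purchases N => (d i : ℝ)) atTop) :=
    tendsto_comap_iff.2 htop
  filter_upwards [hcomap.eventually (M.eventually_buyProb_le σ hi h0 hθ ha)] with t hbuy
  exact (hcond t).trans_le (M.drift_lyapunov_nonpos σ hij ha0 h0 h1 hbuy)

lemma isLittleO_of_tendsto_lyapunov {α : Type*} {l : Filter α} {d : α → Purchases N} {i j : Fin N}
    {a θ c : ℝ} (ha : 0 ≤ a) (hθ : θ < 1) (htop : Tendsto (fun t => (d t i : ℝ)) l atTop)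
    (hconv : Tendsto (fun t => lyapunov a θ i j (d t)) l (𝓝 c)) :
    (fun t => (d t j : ℝ)) =o[l] fun t => (d t i : ℝ) := by
  have hrate : (fun t => (d t j : ℝ)) =O[l] fun t => ((d t i : ℝ) + 1) ^ θ := by
    have hlyapunov (t : α) : a + d t j = lyapunov a θ i j (d t) * ((d t i : ℝ) + 1) ^ θ := by
      rw [lyapunov, mul_assoc, ← Real.rpow_add (by positivity), neg_add_cancel, Real.rpow_zero,
        mul_one]
    have hshift : (fun t => a + (d t j : ℝ)) =O[l] fun t => ((d t i : ℝ) + 1) ^ θ := by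
      simpa only [hlyapunov, one_mul] using
        (hconv.isBigO_one ℝ).mul (Asymptotics.isBigO_refl (fun t => ((d t i : ℝ) + 1) ^ θ) l)
    refine .trans (.of_norm_le fun t => ?_) hshift
    rw [Real.norm_natCast]
    exact le_add_of_nonneg_left ha
  have hone : (fun _ => (1 : ℝ)) =O[l] fun t => (d t i : ℝ) :=
    .of_norm_eventuallyLE ((htop.eventually_ge_atTop 1).mono fun t ht => by simpa using ht)
  exact (hrate.trans_isLittleO (isLittleO_rpow_self_of_lt_one hθ
    (tendsto_atTop_add_const_right _ 1 htop))).trans_isBigO ((Asymptotics.isBigO_refl _ _).add hone)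

lemma ae_isLittleO_purchases {i j : Fin N} (hij : i ≠ j) (hlt : M.score σ j < M.score σ i) :
    ∀ᵐ d ∂(M.purchaseLaw (staticPolicy σ)),
      (fun t => (d t j : ℝ)) =o[atTop] fun t => (d t i : ℝ) := by
  have hi : 0 < M.score σ i := (M.score_nonneg σ j).trans_lt hlt
  obtain ⟨θ, hθ, hθ1⟩ := exists_between ((div_lt_one hi).2 hlt)
  have hθ0 : 0 ≤ θ := (div_nonneg (M.score_nonneg σ j) hi.le).trans hθ.le
  have : Nonempty (Fin K) := ⟨⟨0, M.classes_pos⟩⟩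
  obtain ⟨k, hk⟩ := Finite.exists_max (M.appeal j)
  filter_upwards [M.ae_tendsto_purchases_atTop σ hi, M.ae_exists_tendsto_lyapunov σ hij hi hθ0
    hθ1.le ((div_lt_iff₀' hi).1 hθ) hk] with d htop ⟨c, hc⟩
  exact isLittleO_of_tendsto_lyapunov (M.appeal_pos j k).le hθ1 htop hc

lemma goesToMonopolyFor_of_isStrictBest {i : Fin N} (hi : 0 < M.score σ i)
    (hbest : M.IsStrictBest σ i) : M.GoesToMonopolyFor (staticPolicy σ) i := by
  have hlittle : ∀ᵐ d ∂(M.purchaseLaw (staticPolicy σ)), ∀ j, j ≠ i →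
      (fun t => (d t j : ℝ)) =o[atTop] fun t => (d t i : ℝ) :=
    ae_all_iff.2 fun j => eventually_imp_distrib_left.2 fun hj =>
      M.ae_isLittleO_purchases σ hj.symm (hbest j hj)
  filter_upwards [M.ae_tendsto_purchases_atTop σ hi, hlittle] with d htop hd
  exact tendsto_div_sum_one_of_isLittleO (u := fun j t => (d t j : ℝ)) (htop.eventually_ne_atTop 0)
    hd

lemma avgQuality_le_of_isStrictBest (hσ : M.IsAverageQualityRanking σ) {i : Fin N}
    (hbest : M.IsStrictBest σ i) (j : Fin N) : M.avgQuality j ≤ M.avgQuality i := by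
  obtain hlt | hle := lt_or_ge (σ i) (σ j)
  · exact hσ i j hlt
  · by_contra! hquality
    have hji : j ≠ i := by
      rintro rfl
      exact hquality.false
    exact (hbest j hji).not_ge (mul_le_mul hquality.le (M.visibility_antitone hle)
      (M.visibility_nonneg _) (M.avgQuality_nonneg j))

end MMNL

theorem mainTheorem5 {N K : ℕ} (M : MMNL N K) (σ : Ranking N)
    (hσ : M.IsAverageQualityRanking σ) (htie : M.IsTieBreaking σ)
    (hpos : ∃ i, 0 < M.avgQuality i * M.visibility (σ i)) :
    ∃ i : Fin N, (∀ j, M.avgQuality j ≤ M.avgQuality i) ∧ M.IsStrictBest σ i ∧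
      M.GoesToMonopolyFor (staticPolicy σ) i := by
  obtain ⟨i, hbest⟩ := htie
  obtain ⟨j, hj⟩ := hpos
  have hi : 0 < M.avgQuality i * M.visibility (σ i) := by
    by_cases h : j = i
    · exact h ▸ hj
    · exact hj.trans (hbest j h)
  exact ⟨i, M.avgQuality_le_of_isStrictBest σ hσ hbest, hbest,
    M.goesToMonopolyFor_of_isStrictBest σ hi hbest⟩
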